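/- **Theorem (Regret Lower Bound).** There is a universal constant $c>0$ such that the following holds for all integers $d\ge 1$, $L\ge 1$ and $T\ge 1$. *Setting.* A linear-SEM causal bandit on a directed acyclic graph with a distinguished reward node is given by an observational weight matrix $\mathbf B$ and an interventional weight matrix $\mathbf B^*$, both with non-zero entry $(j,i)$ exactly when $j\to i$ is an edge, and by independent noise terms $\epsilon_i$. An arm is a set $a$ of nodes; $\mathbf B_a$ has the column $[\mathbf B^*]_i$ for $i\in a$ and $[\mathbf B]_i$ for $i\notin a$, and under $a$ one observes the solution $X$ of $X=\mathbf B_a^\top X+\epsilon$. Let $\mu_{i,a}=\mathbb E_a[X_i]$, and let $\mu_a$ be this mean for the reward node. A policy chooses, possibly at random, each arm $a(t)$ on the basis of the past arms and observations, and its expected regret is $\mathbb E[\mathcal R(T)]=T\max_a\mu_a-\mathbb E\big[\sum_{t=1}^T\mu_{a(t)}\big]$. The causal depth of a node is the length of the longest directed path that ends there. *Claim.* Let $\mathcal G$ be the hierarchical graph that has $L$ layers of $d$ nodes and a last layer consisting of the reward node alone, whose edges are all those from each layer to the next. It has maximum in-degree $d$ and maximum causal depth $L$. There are two causal bandit instances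 $I_0,I_1$ on $\mathcal G$ (depending on $d,L,T$) such that every policy satisfies $$\max\big\{\mathbb E_{I_0}[\mathcal R(T)],\ \mathbb E_{I_1}[\mathcal R(T)]\big\}\ \ge\ c\,d^{\,L-\frac32}\sqrt T .$$ In both instances all weights have absolute value at most $1$, the noise is $\mathcal N(1,1)$ at the nodes of the first layer and $\mathcal N(0,1)$ at all other nodes, and for some $\eta>0$ (depending on the instance) every intervention on a single node $i$ of causal depth at least $1$ shifts the mean of $i$ and of each of its descendants by more than $\eta$, that is, $|\mu_{j,\emptyset}-\mu_{j,\{i\}}|>\eta$. -/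

import Mathlib

open MeasureTheory ProbabilityTheory

/-- A causal bandit instance with a linear structural equation model on the nodes `0, …, n`;
the last node carries the reward. `B j i` (resp. `Bstar j i`) is the weight of the edge `j → i`
without (resp. with) a soft intervention on `i`. A soft intervention keeps the parents of a node.
The noise terms are independent, `noise i` being the law of the noise at node `i`. -/
structure CausalBandit (n : ℕ) where
  edge : Fin (n + 1) → Fin (n + 1) → Prop
  acyclic : ∀ i, ¬ Relation.TransGen edge i i
  B : Matrix (Fin (n + 1)) (Fin (n + 1)) ℝ
  Bstar : Matrix (Fin (n + 1)) (Fin (n + 1)) ℝ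
  B_ne_zero_iff : ∀ j i, B j i ≠ 0 ↔ edge j i
  Bstar_ne_zero_iff : ∀ j i, Bstar j i ≠ 0 ↔ edge j i
  noise : Fin (n + 1) → Measure ℝ
  noise_prob : ∀ i, IsProbabilityMeasure (noise i)
  noise_integrable : ∀ i, Integrable (fun x : ℝ => x) (noise i)

namespace CausalBandit

variable {n : ℕ}

/-! ### The causal graph -/

/-- Length of the longest directed path ending at `i`. -/
noncomputable def causalDepth (I : CausalBandit n) (i : Fin (n + 1)) : ℕ :=
  sSup {k : ℕ | ∃ p : Fin (k + 1) → Fin (n + 1),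
    (∀ m : Fin k, I.edge (p m.castSucc) (p m.succ)) ∧ p (Fin.last k) = i}

noncomputable def maxCausalDepth (I : CausalBandit n) : ℕ :=
  Finset.univ.sup I.causalDepth

noncomputable def maxInDegree (I : CausalBandit n) : ℕ :=
  Finset.univ.sup fun i => {j | I.edge j i}.ncard

/-- The nodes are grouped into consecutive layers of `d` nodes, node `i` being in layer `i / d`,
and the edges are exactly those from a layer to the next one. For `n = d * L` these are `L` layers
of `d` nodes each, followed by a last layer that consists of the reward node alone. -/
def IsHierarchical (I : CausalBandit n) (d : ℕ) : Prop :=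
  ∀ j i : Fin (n + 1), I.edge j i ↔ (i : ℕ) / d = (j : ℕ) / d + 1

/-! ### The linear model under soft interventions -/

/-- The weight matrix after the soft intervention on the nodes in `a`. -/
noncomputable def weights (I : CausalBandit n) (a : Finset (Fin (n + 1))) :
    Matrix (Fin (n + 1)) (Fin (n + 1)) ℝ :=
  Matrix.of fun j i => if i ∈ a then I.Bstar j i else I.B j i

/-- The solution `X` of the structural equations `X = (B_a)ᵀ X + ε`. -/
noncomputable def solution (I : CausalBandit n) (a : Finset (Fin (n + 1)))
    (ε : Fin (n + 1) → ℝ) : Fin (n + 1) → ℝ :=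
  (1 - (I.weights a).transpose)⁻¹.mulVec ε

theorem weights_ne_zero_iff (I : CausalBandit n) (a : Finset (Fin (n + 1)))
    (j i : Fin (n + 1)) : I.weights a j i ≠ 0 ↔ I.edge j i := by
  by_cases h : i ∈ a
  · simpa [weights, h] using I.Bstar_ne_zero_iff j i
  · simpa [weights, h] using I.B_ne_zero_iff j i

theorem isUnit_one_sub (I : CausalBandit n) (a : Finset (Fin (n + 1))) :
    IsUnit (1 - (I.weights a).transpose) := by
  rw [← Matrix.mulVec_injective_iff_isUnit]
  have key : ∀ v : Fin (n + 1) → ℝ,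
      (1 - (I.weights a).transpose).mulVec v = 0 → v = 0 := by
    intro v hv
    have hwf : WellFounded (Relation.TransGen I.edge) := by
      have : Std.Irrefl (Relation.TransGen I.edge) := ⟨I.acyclic⟩
      exact Finite.wellFounded_of_trans_of_irrefl _
    funext i
    induction i using hwf.induction with
    | _ i ih =>
      have h := congrFun hv i
      rw [Matrix.sub_mulVec, Matrix.one_mulVec] at h
      have h0 : (I.weights a).transpose.mulVec v i = 0 := by
        rw [Matrix.mulVec, dotProduct]
        refine Finset.sum_eq_zero fun j _ => ?_
        by_cases hj : I.weights a j i = 0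
        · simp [Matrix.transpose_apply, hj]
        · rw [ih j (Relation.TransGen.single ((I.weights_ne_zero_iff a j i).1 hj))]
          simp
      simpa [h0] using h
  intro v w hvw
  refine sub_eq_zero.1 (key (v - w) ?_)
  rw [Matrix.mulVec_sub]
  exact sub_eq_zero.2 hvw

/-- `solution` is indeed the unique solution of the structural equations. -/
theorem eq_solution_iff (I : CausalBandit n) (a : Finset (Fin (n + 1)))
    (ε x : Fin (n + 1) → ℝ) :
    x = I.solution a ε ↔ x = (I.weights a).transpose.mulVec x + ε := by
  have hu := (Matrix.isUnit_iff_isUnit_det _).1 (I.isUnit_one_sub a)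
  constructor
  · intro h
    have h1 : (1 - (I.weights a).transpose).mulVec x = ε := by
      rw [h, solution, Matrix.mulVec_mulVec, Matrix.mul_nonsing_inv _ hu, Matrix.one_mulVec]
    rw [Matrix.sub_mulVec, Matrix.one_mulVec] at h1
    rw [← h1]
    abel
  · intro h
    have h1 : ε = (1 - (I.weights a).transpose).mulVec x := by
      rw [Matrix.sub_mulVec, Matrix.one_mulVec]
      exact eq_sub_of_add_eq' h.symm
    rw [solution, h1, Matrix.mulVec_mulVec, Matrix.nonsing_inv_mul _ hu, Matrix.one_mulVec]

/-- The law of the observed vector `X` under each intervention. -/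
noncomputable def obs (I : CausalBandit n) :
    Kernel (Finset (Fin (n + 1))) (Fin (n + 1) → ℝ) :=
  Kernel.ofFunOfCountable fun a => (Measure.pi I.noise).map (I.solution a)

instance (I : CausalBandit n) : IsMarkovKernel I.obs := by
  refine ⟨fun a => ?_⟩
  have := I.noise_prob
  have hm : Measurable (I.solution a) :=
    (Matrix.mulVecLin (1 - (I.weights a).transpose)⁻¹).continuous_of_finiteDimensional.measurable
  exact Measure.isProbabilityMeasure_map hm.aemeasurable

/-- The expected value of `X_i` under the intervention `a`. -/
noncomputable def mean (I : CausalBandit n) (i : Fin (n + 1)) (a : Finset (Fin (n + 1))) : ℝ :=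
  ∫ x, x i ∂(I.obs a)

/-- The expected reward under an optimal intervention. -/
noncomputable def optMean (I : CausalBandit n) : ℝ :=
  Finset.univ.sup' Finset.univ_nonempty fun a => I.mean (Fin.last n) a

/-! ### Conditions on an instance -/

/-- All weights have absolute value at most `1`. -/
def WeightsBounded (I : CausalBandit n) : Prop :=
  ∀ j i, |I.B j i| ≤ 1 ∧ |I.Bstar j i| ≤ 1

/-- The noise is Gaussian of variance one, of mean one at the nodes without parents and
of mean zero at all others. -/
def GaussianNoise (I : CausalBandit n) : Prop :=
  ∀ i, I.noise i = gaussianReal (if I.causalDepth i = 0 then 1 else 0) 1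

/-- An intervention on a single node `i` that has a parent shifts the mean of `i` and of every
descendant of `i` by more than `η`. -/
def InterventionRegular (I : CausalBandit n) (η : ℝ) : Prop :=
  ∀ i j, 1 ≤ I.causalDepth i → Relation.ReflTransGen I.edge i j →
    η < |I.mean j ∅ - I.mean j {i}|

end CausalBandit

/-! ### Policies, interaction and regret -/

/-- One round: the intervention that is played and the vector that is observed. -/
abbrev BanditRound (n : ℕ) : Type := Finset (Fin (n + 1)) × (Fin (n + 1) → ℝ)

/-- A (possibly randomized) policy: it chooses the next intervention at random according to a law
that depends measurably on the `t` rounds played so far. -/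
structure BanditPolicy (n : ℕ) where
  act : (t : ℕ) → Kernel (Fin t → BanditRound n) (Finset (Fin (n + 1)))
  act_markov : ∀ t, IsMarkovKernel (act t)

namespace CausalBandit

variable {n : ℕ}

/-- The law of the first `t` rounds of interaction of a policy with an instance: given the past,
the policy draws an intervention `a`, and then `X` is drawn from `I.obs a`. -/
noncomputable def law (I : CausalBandit n) (π : BanditPolicy n) :
    (t : ℕ) → Measure (Fin t → BanditRound n)
  | 0 => Measure.dirac Fin.elim0
  | t + 1 => (I.law π t ⊗ₘ (π.act t ⊗ₖ Kernel.prodMkLeft (Fin t → BanditRound n) I.obs)).map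
      fun p => (Fin.snoc p.1 p.2 : Fin (t + 1) → BanditRound n)

theorem measurable_snoc_round (t : ℕ) : Measurable
    fun p : (Fin t → BanditRound n) × BanditRound n =>
      (Fin.snoc p.1 p.2 : Fin (t + 1) → BanditRound n) := by
  refine measurable_pi_lambda _ fun i => ?_
  refine Fin.lastCases ?_ (fun j => ?_) i
  · simpa using measurable_snd
  · simp only [Fin.snoc_castSucc]
    exact (measurable_pi_apply j).comp measurable_fst

instance (I : CausalBandit n) (π : BanditPolicy n) (t : ℕ) :
    IsProbabilityMeasure (I.law π t) := by
  induction t with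
  | zero => rw [law]; infer_instance
  | succ t ih =>
    have := π.act_markov t
    rw [law]
    exact Measure.isProbabilityMeasure_map (measurable_snoc_round t).aemeasurable

/-- The expected cumulative regret over `T` rounds. -/
noncomputable def expectedRegret (I : CausalBandit n) (π : BanditPolicy n) (T : ℕ) : ℝ :=
  T * I.optMean - ∫ h, ∑ t, I.mean (Fin.last n) (h t).1 ∂(I.law π T)

end CausalBandit

open scoped ENNReal

/-! ### Gaussian densities -/

/-! This is a two-point argument in which only the weights into layer 1 (the first layer with
parents) are uncertain. Intervening there sets the weight to `1/2`; not intervening leaves `1/2 - s`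
in one instance and `1/2 + s` in the other. In all later layers the weight drops from `1` to `1/2`
under intervention. The reward mean counts weighted paths, so a difference `s` in layer 1 is
amplified to `d ^ L * s` at the reward node. The first instance can earn `d ^ L / 2` by intervening
on all of layer 1, the second earns `d ^ L * (1/2 + s)` by doing nothing, while the means of any
single arm in the two instances add up to at most `d ^ L`. Hence each round costs at least `d ^ L *
s` in the sum of the two gaps (`pow_mul_le_gap_add_gap`).

Both laws are compared with the law `Q` of the unperturbed instance `s = 0`. If `D₀`, `D₁` are the
densities of the whole interaction, opposite Gaussian shifts cancel to first order, so that `√(D₀ *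
D₁) = exp (-∑ q)` with `q` half the squared shift (`densityRatio_mul`). By `exp (-x) ≥ 1 - x` and a
comparison of the geometric mean with the minimum, `∫ min D₀ D₁ ∂Q ≥ 1/4` as soon as the expectation
of `∑ q` is at most `1/4`; the regrets then add up to at least `T * d ^ L * s / 4`
(`le_expectedRegret_add`).

One round contributes at most `d ^ 3 * s ^ 2` to `∑ q` on average: there are at most `d` perturbed
nodes, each shifted by `s` times a sum of `d` sources (`lintegral_information_le`). So `s` can be of
order `d ^ (-3/2) * T ^ (-1/2)`, which gives the rate. -/

theorem lintegral_pi_gaussianReal {ι : Type*} [Fintype ι] (m : ι → ℝ) {f : (ι → ℝ) → ℝ≥0∞}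
    (hf : Measurable f) :
    ∫⁻ x, f x ∂(Measure.pi fun i => gaussianReal (m i) 1) =
      ∫⁻ x, f x * ENNReal.ofReal (∏ i, gaussianPDFReal (m i) 1 (x i)) := by
  have hm : Measurable fun x : ι → ℝ => ENNReal.ofReal (∏ i, gaussianPDFReal (m i) 1 (x i)) := by
    fun_prop
  have h : (Measure.pi fun i => gaussianReal (m i) 1) =
      (volume : Measure (ι → ℝ)).withDensity
        fun x => ENNReal.ofReal (∏ i, gaussianPDFReal (m i) 1 (x i)) := by
    refine Measure.pi_eq fun s hs => ?_
    rw [withDensity_apply _ (MeasurableSet.univ_pi hs), volume_pi, Measure.restrict_pi_pi,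
      ← ofReal_integral_eq_lintegral_ofReal
        (Integrable.fintype_prod fun i => (integrable_gaussianPDFReal (m i) 1).integrableOn)
        (ae_of_all _ fun x => Finset.prod_nonneg fun i _ => gaussianPDFReal_nonneg _ _ _),
      integral_fintype_prod_eq_prod, ENNReal.ofReal_prod_of_nonneg fun i _ =>
        integral_nonneg fun x => gaussianPDFReal_nonneg _ _ _]
    exact Finset.prod_congr rfl fun i _ =>
      (gaussianReal_apply_eq_integral (m i) one_ne_zero (s i)).symm
  rw [h, lintegral_withDensity_eq_lintegral_mul _ hm hf]
  simp only [Pi.mul_apply, mul_comm]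

theorem lintegral_sq_gaussianReal_one_one :
    ∫⁻ x, ENNReal.ofReal (x ^ 2) ∂(gaussianReal 1 1) = 2 := by
  have hL : MemLp (id : ℝ → ℝ) 2 (gaussianReal 1 1) := memLp_id_gaussianReal' 2 (by simp)
  have hi : Integrable (fun x : ℝ => x ^ 2) (gaussianReal 1 1) := hL.integrable_sq
  rw [← ofReal_integral_eq_lintegral_ofReal hi (ae_of_all _ fun x => sq_nonneg x)]
  have h := variance_eq_sub hL
  rw [variance_id_gaussianReal] at h
  have h1 : ∫ x : ℝ, id x ∂(gaussianReal 1 1) = 1 := integral_id_gaussianReal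
  rw [h1] at h
  have h2 : ∫ x : ℝ, x ^ 2 ∂(gaussianReal 1 1) = 2 := by
    simp only [Pi.pow_apply, NNReal.coe_one, id] at h
    linarith
  rw [h2]
  simp

/-- The terms linear in `v` in the two exponents cancel; only a factor that does not involve `y - m`
remains. -/
theorem gaussianPDFReal_sub_mul_gaussianPDFReal_add (m y v : ℝ) :
    gaussianPDFReal m 1 (y - v) * gaussianPDFReal m 1 (y + v) =
      gaussianPDFReal m 1 y ^ 2 * Real.exp (-v ^ 2) := by
  simp only [gaussianPDFReal]
  rw [mul_mul_mul_comm, ← Real.exp_add, mul_pow, ← Real.exp_nat_mul, mul_assoc (_ ^ 2),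
    ← Real.exp_add, ← sq]
  congr 2
  push_cast
  ring

namespace CausalBandit

variable {n : ℕ}

/-! ### The observations -/

theorem measurable_solution (I : CausalBandit n) (a : Finset (Fin (n + 1))) :
    Measurable (I.solution a) :=
  (Matrix.mulVecLin (1 - (I.weights a).transpose)⁻¹).continuous_of_finiteDimensional.measurable

theorem obs_apply (I : CausalBandit n) (a : Finset (Fin (n + 1))) :
    I.obs a = (Measure.pi I.noise).map (I.solution a) := rfl

/-- The solution is linear in the noise, so expectation passes through it. -/
theorem mean_eq_solution (I : CausalBandit n) (a : Finset (Fin (n + 1))) :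
    (fun i => I.mean i a) = I.solution a fun i => ∫ x, x ∂(I.noise i) := by
  have := I.noise_prob
  funext i
  rw [mean, obs_apply, integral_map (I.measurable_solution a).aemeasurable
    (measurable_pi_apply i).aestronglyMeasurable]
  simp only [solution, Matrix.mulVec, dotProduct]
  rw [integral_finsetSum]
  · refine Finset.sum_congr rfl fun j _ => ?_
    rw [integral_const_mul]
    congr 1
    exact integral_comp_eval (μ := I.noise) (f := fun x : ℝ => x) (by fun_prop)
  · exact fun j _ => (integrable_comp_eval (μ := I.noise) (f := fun x : ℝ => x)
      (I.noise_integrable j)).const_mul _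

theorem mean_eq_sum_add (I : CausalBandit n) (a : Finset (Fin (n + 1))) (i : Fin (n + 1)) :
    I.mean i a = ∑ j, I.weights a j i * I.mean j a + ∫ x, x ∂(I.noise i) :=
  congrFun ((I.eq_solution_iff a _ _).1 (I.mean_eq_solution a)) i

/-- The density of the observations of a Gaussian model. -/
theorem lintegral_obs_of_gaussian (I : CausalBandit n) {m : Fin (n + 1) → ℝ}
    (hm : ∀ i, I.noise i = gaussianReal (m i) 1) (a : Finset (Fin (n + 1)))
    (hdet : (1 - (I.weights a).transpose).det = 1) {f : (Fin (n + 1) → ℝ) → ℝ≥0∞}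
    (hf : Measurable f) :
    ∫⁻ x, f x ∂(I.obs a) = ∫⁻ x, f x * ENNReal.ofReal
      (∏ i, gaussianPDFReal (m i) 1 (x i - (I.weights a).transpose.mulVec x i)) := by
  have hs := I.measurable_solution a
  -- Passing from observation to noise has Jacobian one, so it preserves Lebesgue measure.
  have hvol := Real.map_matrix_volume_pi_eq_smul_volume_pi
    (M := 1 - (I.weights a).transpose) (by rw [hdet]; exact one_ne_zero)
  rw [hdet, inv_one, abs_one, ENNReal.ofReal_one, one_smul] at hvol
  rw [obs_apply, lintegral_map hf hs, show I.noise = fun i => gaussianReal (m i) 1 from funext hm,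
    lintegral_pi_gaussianReal m (f := fun x => f (I.solution a x)) (hf.comp hs)]
  conv_lhs => rw [← hvol]
  rw [lintegral_map (by fun_prop) (LinearMap.continuous_of_finiteDimensional _).measurable]
  refine lintegral_congr fun x => ?_
  have hx : x = I.solution a ((1 - (I.weights a).transpose).mulVec x) := by
    rw [eq_solution_iff, Matrix.sub_mulVec, Matrix.one_mulVec]
    abel
  rw [Matrix.toLin'_apply, ← hx,
    Matrix.sub_mulVec, Matrix.one_mulVec]
  rfl

/-! ### Change of measure along a policy -/

theorem lintegral_law_succ (I : CausalBandit n) (π : BanditPolicy n) (t : ℕ)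
    {f : (Fin (t + 1) → BanditRound n) → ℝ≥0∞} (hf : Measurable f) :
    ∫⁻ h, f h ∂(I.law π (t + 1)) = ∫⁻ h, ∫⁻ a, ∫⁻ x,
      f (Fin.snoc (α := fun _ => BanditRound n) h (a, x))
        ∂(I.obs a) ∂(π.act t h) ∂(I.law π t) := by
  have := π.act_markov t
  have hg : Measurable fun p : (Fin t → BanditRound n) × BanditRound n =>
      f (Fin.snoc (α := fun _ => BanditRound n) p.1 p.2) := hf.comp (measurable_snoc_round t)
  rw [law, lintegral_map hf (measurable_snoc_round t), Measure.lintegral_compProd hg]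
  refine lintegral_congr fun h => ?_
  rw [Kernel.lintegral_compProd _ _ _
    (f := fun b => f (Fin.snoc (α := fun _ => BanditRound n) h b)) (hg.comp measurable_prodMk_left)]
  simp [Kernel.prodMkLeft_apply]

theorem measurable_lintegral_round (I : CausalBandit n) (π : BanditPolicy n) (t : ℕ)
    {f : (Fin (t + 1) → BanditRound n) → ℝ≥0∞} (hf : Measurable f) :
    Measurable fun h => ∫⁻ a, ∫⁻ x, f (Fin.snoc (α := fun _ => BanditRound n) h (a, x))
        ∂(I.obs a) ∂(π.act t h) := by
  have := π.act_markov t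
  have hg : Measurable fun p : (Fin t → BanditRound n) × BanditRound n =>
      f (Fin.snoc (α := fun _ => BanditRound n) p.1 p.2) := hf.comp (measurable_snoc_round t)
  have h1 := hg.lintegral_kernel_prod_right'
    (κ := π.act t ⊗ₖ Kernel.prodMkLeft (Fin t → BanditRound n) I.obs)
  convert h1 using 2 with h
  rw [Kernel.lintegral_compProd _ _ _
    (f := fun b => f (Fin.snoc (α := fun _ => BanditRound n) h b)) (hg.comp measurable_prodMk_left)]
  simp [Kernel.prodMkLeft_apply]

/-- `r` is a density of the observations of `I` with respect to those of `Q`, for every arm. -/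
structure IsObsDensity (I Q : CausalBandit n) (r : BanditRound n → ℝ) : Prop where
  measurable : Measurable r
  nonneg : ∀ p, 0 ≤ r p
  lintegral_eq : ∀ a (f : (Fin (n + 1) → ℝ) → ℝ≥0∞), Measurable f →
    ∫⁻ x, f x ∂(I.obs a) = ∫⁻ x, f x * ENNReal.ofReal (r (a, x)) ∂(Q.obs a)

/-- The policy draws its arms by the same kernels in both laws, so only the observations contribute
to the density. In the induction the factor of the last round is absorbed into the integrand before
the hypothesis is applied to the first `t` rounds. -/
theorem IsObsDensity.lintegral_law {I Q : CausalBandit n} {r : BanditRound n → ℝ}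
    (hr : IsObsDensity I Q r) (π : BanditPolicy n) (t : ℕ)
    {f : (Fin t → BanditRound n) → ℝ≥0∞} (hf : Measurable f) :
    ∫⁻ h, f h ∂(I.law π t) = ∫⁻ h, f h * ENNReal.ofReal (∏ i, r (h i)) ∂(Q.law π t) := by
  have hrm := hr.measurable
  induction t with
  | zero => simp [law]
  | succ t ih =>
    have hs := measurable_snoc_round (n := n) t
    have hg : Measurable fun h : Fin (t + 1) → BanditRound n =>
        f h * ENNReal.ofReal (r (h (Fin.last t))) := by fun_prop
    have hsx : ∀ h : Fin t → BanditRound n, ∀ a, Measurable fun x : Fin (n + 1) → ℝ =>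
        (Fin.snoc h (a, x) : Fin (t + 1) → BanditRound n) := fun h a =>
      hs.comp (measurable_prodMk_left.comp measurable_prodMk_left)
    have hint : ∀ h : Fin t → BanditRound n,
        ∫⁻ a, ∫⁻ x, f (Fin.snoc (α := fun _ => BanditRound n) h (a, x)) ∂(I.obs a) ∂(π.act t h) =
        ∫⁻ a, ∫⁻ x, f (Fin.snoc (α := fun _ => BanditRound n) h (a, x)) *
          ENNReal.ofReal (r (a, x)) ∂(Q.obs a) ∂(π.act t h) := fun h =>
      lintegral_congr fun a => hr.lintegral_eq a _ (hf.comp (hsx h a))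
    have hQm := Q.measurable_lintegral_round π t hg
    simp only [Fin.snoc_last] at hQm
    rw [I.lintegral_law_succ π t hf, Q.lintegral_law_succ π t (by fun_prop)]
    simp only [hint]
    rw [ih hQm]
    refine lintegral_congr fun h => ?_
    rw [← lintegral_mul_const' _ _ ENNReal.ofReal_ne_top]
    refine lintegral_congr fun a => ?_
    rw [← lintegral_mul_const' _ _ ENNReal.ofReal_ne_top]
    refine lintegral_congr fun x => ?_
    simp only [Fin.prod_univ_castSucc, Fin.snoc_castSucc, Fin.snoc_last]
    rw [ENNReal.ofReal_mul (Finset.prod_nonneg fun i _ => hr.nonneg _), mul_assoc]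
    congr 1
    exact mul_comm _ _

/-- The bound `κ` is uniform over arms, hence holds conditionally on the past however the arm is
chosen. -/
theorem lintegral_law_sum_le (Q : CausalBandit n) (π : BanditPolicy n) {q : BanditRound n → ℝ≥0∞}
    (hq : Measurable q) {κ : ℝ≥0∞} (hκ : ∀ a, ∫⁻ x, q (a, x) ∂(Q.obs a) ≤ κ) (t : ℕ) :
    ∫⁻ h, ∑ i, q (h i) ∂(Q.law π t) ≤ t * κ := by
  induction t with
  | zero => simp
  | succ t ih =>
    have := π.act_markov t
    rw [Q.lintegral_law_succ π t (by fun_prop)]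
    simp only [Fin.sum_univ_castSucc, Fin.snoc_castSucc, Fin.snoc_last]
    calc _ ≤ ∫⁻ h, (∑ i, q (h i) + κ) ∂(Q.law π t) := by
          refine lintegral_mono fun h => ?_
          calc _ ≤ ∫⁻ a, (∑ i, q (h i) + κ) ∂(π.act t h) := by
                refine lintegral_mono fun a => ?_
                rw [lintegral_add_left measurable_const]
                simpa using add_le_add_right (hκ a) _
            _ = _ := by simp
      _ ≤ t * κ + κ := by
          rw [lintegral_add_right _ measurable_const]
          simpa using add_le_add_left ih κ
      _ = _ := by push_cast; ring

/-! ### The two-point method -/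

theorem mean_le_optMean (I : CausalBandit n) (a : Finset (Fin (n + 1))) :
    I.mean (Fin.last n) a ≤ I.optMean :=
  Finset.le_sup' (fun a => I.mean (Fin.last n) a) (Finset.mem_univ a)

theorem integrable_sum_gap (I : CausalBandit n) (π : BanditPolicy n) (T : ℕ) :
    Integrable (fun h : Fin T → BanditRound n =>
      ∑ t, (I.optMean - I.mean (Fin.last n) (h t).1)) (I.law π T) := by
  have hm : Measurable fun a : Finset (Fin (n + 1)) => I.mean (Fin.last n) a :=
    measurable_of_countable _
  refine integrable_finsetSum _ fun t _ => (integrable_const _).sub ?_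
  refine Integrable.of_bound (C := ∑ a, |I.mean (Fin.last n) a|)
    (by fun_prop : Measurable _).aestronglyMeasurable (ae_of_all _ fun h => ?_)
  exact Finset.single_le_sum (f := fun a => |I.mean (Fin.last n) a|)
    (fun a _ => abs_nonneg _) (Finset.mem_univ (h t).1)

theorem expectedRegret_eq_integral (I : CausalBandit n) (π : BanditPolicy n) (T : ℕ) :
    I.expectedRegret π T =
      ∫ h, ∑ t, (I.optMean - I.mean (Fin.last n) (h t).1) ∂(I.law π T) := by
  have h := integral_sub (integrable_const (T * I.optMean)) (I.integrable_sum_gap π T)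
  have h2 : ∀ h : Fin T → BanditRound n, T * I.optMean -
      ∑ t, (I.optMean - I.mean (Fin.last n) (h t).1) = ∑ t, I.mean (Fin.last n) (h t).1 := by
    intro h
    simp
  simp only [h2] at h
  rw [expectedRegret, h]
  simp

theorem sum_gap_nonneg (I : CausalBandit n) {T : ℕ} (h : Fin T → BanditRound n) :
    0 ≤ ∑ t, (I.optMean - I.mean (Fin.last n) (h t).1) :=
  Finset.sum_nonneg fun _ _ => sub_nonneg.2 (I.mean_le_optMean _)

theorem expectedRegret_nonneg (I : CausalBandit n) (π : BanditPolicy n) (T : ℕ) :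
    0 ≤ I.expectedRegret π T := by
  rw [expectedRegret_eq_integral]
  exact integral_nonneg fun h => I.sum_gap_nonneg h

theorem IsObsDensity.ofReal_expectedRegret {I Q : CausalBandit n} {r : BanditRound n → ℝ}
    (hr : IsObsDensity I Q r) (π : BanditPolicy n) (T : ℕ) :
    ENNReal.ofReal (I.expectedRegret π T) =
      ∫⁻ h, ENNReal.ofReal (∑ t, (I.optMean - I.mean (Fin.last n) (h t).1)) *
        ENNReal.ofReal (∏ i, r (h i)) ∂(Q.law π T) := by
  have hm : Measurable fun a : Finset (Fin (n + 1)) => I.mean (Fin.last n) a :=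
    measurable_of_countable _
  rw [expectedRegret_eq_integral, ofReal_integral_eq_lintegral_ofReal (I.integrable_sum_gap π T)
    (ae_of_all _ fun h => I.sum_gap_nonneg h), hr.lintegral_law π T (by fun_prop)]

/-- With `m` the minimum and `M` the maximum, AM-GM gives `√(m * M) ≤ m + M / 4`. The factor `1/4`
is small enough that two probability densities in place of `p`, `q` lose only `1/2` after
integration. -/
theorem _root_.Real.sqrt_mul_le_min_add {p q : ℝ} (hp : 0 ≤ p) (hq : 0 ≤ q) :
    √(p * q) ≤ min p q + (p + q) / 4 := by
  rw [Real.sqrt_le_left (by positivity)]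
  rcases min_cases p q with ⟨h, _⟩ | ⟨h, _⟩ <;> rw [h] <;>
    nlinarith [mul_nonneg hp hq, sq_nonneg (5 * p - q), sq_nonneg (5 * q - p), sq_nonneg p,
      sq_nonneg q]

/-- If the observations of `I₀` and `I₁` are hard to tell apart and no arm is good for both, then
every policy has large regret for one of them. -/
theorem le_expectedRegret_add (I₀ I₁ Q : CausalBandit n) {r₀ r₁ q : BanditRound n → ℝ}
    (h₀ : IsObsDensity I₀ Q r₀) (h₁ : IsObsDensity I₁ Q r₁)
    (hq : Measurable q) (hq0 : ∀ p, 0 ≤ q p) (hrq : ∀ p, r₀ p * r₁ p = Real.exp (-(2 * q p)))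
    {T : ℕ} {κ : ℝ≥0∞} (hκ : ∀ a, ∫⁻ x, ENNReal.ofReal (q (a, x)) ∂(Q.obs a) ≤ κ)
    (hTκ : T * κ ≤ ENNReal.ofReal (1 / 4)) {G : ℝ}
    (hG : ∀ a, G ≤ (I₀.optMean - I₀.mean (Fin.last n) a) +
      (I₁.optMean - I₁.mean (Fin.last n) a)) (π : BanditPolicy n) :
    T * G / 4 ≤ I₀.expectedRegret π T + I₁.expectedRegret π T := by
  have hr₀ := h₀.measurable
  have hr₁ := h₁.measurable
  set D₀ : (Fin T → BanditRound n) → ℝ := fun h => ∏ i, r₀ (h i) with hD₀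
  set D₁ : (Fin T → BanditRound n) → ℝ := fun h => ∏ i, r₁ (h i) with hD₁
  have hD₀m : Measurable D₀ := by fun_prop
  have hD₁m : Measurable D₁ := by fun_prop
  have hD₀n : ∀ h, 0 ≤ D₀ h := fun h => Finset.prod_nonneg fun i _ => h₀.nonneg _
  have hD₁n : ∀ h, 0 ≤ D₁ h := fun h => Finset.prod_nonneg fun i _ => h₁.nonneg _
  have hI₀ : ∫⁻ h, ENNReal.ofReal (D₀ h) ∂(Q.law π T) = 1 := by
    have := h₀.lintegral_law π T (f := fun _ => 1) measurable_const
    simpa using this.symm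
  have hI₁ : ∫⁻ h, ENNReal.ofReal (D₁ h) ∂(Q.law π T) = 1 := by
    have := h₁.lintegral_law π T (f := fun _ => 1) measurable_const
    simpa using this.symm
  -- This is `1 - ∑ q ≤ exp (-∑ q) = √(D₀ * D₁) ≤ min D₀ D₁ + (D₀ + D₁) / 4`, rearranged to avoid
  -- subtraction in `ℝ≥0∞`.
  have hpt : ∀ h, (1 : ℝ≥0∞) ≤ ENNReal.ofReal (min (D₀ h) (D₁ h)) +
      (ENNReal.ofReal (1 / 4) * ENNReal.ofReal (D₀ h) +
        ENNReal.ofReal (1 / 4) * ENNReal.ofReal (D₁ h)) + ∑ i, ENNReal.ofReal (q (h i)) := by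
    intro h
    have hS : 0 ≤ ∑ i, q (h i) := Finset.sum_nonneg fun i _ => hq0 _
    have hDD : √(D₀ h * D₁ h) = Real.exp (-∑ i, q (h i)) := by
      have : D₀ h * D₁ h = Real.exp (-∑ i, q (h i)) ^ 2 := by
        rw [hD₀, hD₁, ← Finset.prod_mul_distrib, ← Real.exp_nat_mul]
        simp only [hrq]
        rw [← Real.exp_sum, Finset.sum_neg_distrib, ← Finset.mul_sum]
        push_cast
        ring_nf
      rw [this, Real.sqrt_sq (Real.exp_pos _).le]
    have h1 := Real.sqrt_mul_le_min_add (hD₀n h) (hD₁n h)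
    have h2 := Real.add_one_le_exp (-∑ i, q (h i))
    have hmin := le_min (hD₀n h) (hD₁n h)
    rw [← ENNReal.ofReal_mul (by norm_num), ← ENNReal.ofReal_mul (by norm_num),
      ← ENNReal.ofReal_sum_of_nonneg fun i _ => hq0 _,
      ← ENNReal.ofReal_add (by linarith [hD₀n h]) (by linarith [hD₁n h]),
      ← ENNReal.ofReal_add hmin (by linarith [hD₀n h, hD₁n h]),
      ← ENNReal.ofReal_add (by linarith [hD₀n h, hD₁n h]) hS, ENNReal.one_le_ofReal]
    linarith
  have hmin : ENNReal.ofReal (1 / 4) ≤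
      ∫⁻ h, ENNReal.ofReal (min (D₀ h) (D₁ h)) ∂(Q.law π T) := by
    have h1 := lintegral_mono (μ := Q.law π T) hpt
    rw [lintegral_const, measure_univ, one_mul, lintegral_add_left (by fun_prop),
      lintegral_add_left (by fun_prop), lintegral_add_left (by fun_prop),
      lintegral_const_mul _ (by fun_prop), lintegral_const_mul _ (by fun_prop), hI₀, hI₁,
      mul_one] at h1
    have h2 := (Q.lintegral_law_sum_le π hq.ennreal_ofReal hκ T).trans hTκ
    have h3 := h1.trans (add_le_add_right h2 _)
    rw [add_assoc, ← ENNReal.ofReal_add (by norm_num) (by norm_num),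
      ← ENNReal.ofReal_add (by norm_num) (by norm_num)] at h3
    -- Of the total mass `1`, the two densities use `1/4` each and the information at most `1/4`;
    -- the overlap keeps the rest.
    refine ENNReal.le_of_add_le_add_right (a := ENNReal.ofReal (1 / 4 + 1 / 4 + 1 / 4))
      ENNReal.ofReal_ne_top (le_trans (le_of_eq ?_) h3)
    rw [← ENNReal.ofReal_add (by norm_num) (by norm_num)]
    norm_num
  rw [← ENNReal.ofReal_le_ofReal_iff
    (add_nonneg (I₀.expectedRegret_nonneg π T) (I₁.expectedRegret_nonneg π T)),
    ENNReal.ofReal_add (I₀.expectedRegret_nonneg π T) (I₁.expectedRegret_nonneg π T),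
    h₀.ofReal_expectedRegret, h₁.ofReal_expectedRegret]
  have hm : Measurable fun a : Finset (Fin (n + 1)) => I₀.mean (Fin.last n) a :=
    measurable_of_countable _
  calc ENNReal.ofReal (T * G / 4) = ENNReal.ofReal (1 / 4) * ENNReal.ofReal (T * G) := by
        rw [← ENNReal.ofReal_mul (by norm_num)]
        ring_nf
    _ ≤ (∫⁻ h, ENNReal.ofReal (min (D₀ h) (D₁ h)) ∂(Q.law π T)) * ENNReal.ofReal (T * G) := by
        gcongr
    _ = ∫⁻ h, ENNReal.ofReal (min (D₀ h) (D₁ h)) * ENNReal.ofReal (T * G) ∂(Q.law π T) := by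
        rw [lintegral_mul_const' _ _ ENNReal.ofReal_ne_top]
    _ ≤ ∫⁻ h, (ENNReal.ofReal (∑ t, (I₀.optMean - I₀.mean (Fin.last n) (h t).1)) *
          ENNReal.ofReal (D₀ h) +
        ENNReal.ofReal (∑ t, (I₁.optMean - I₁.mean (Fin.last n) (h t).1)) *
          ENNReal.ofReal (D₁ h)) ∂(Q.law π T) := by
        refine lintegral_mono fun h => ?_
        -- Every round costs at least `G` in the two gaps together, whatever its arm; the common
        -- weight `min D₀ D₁` allows the two regrets to be added pointwise.
        have hTG : T * G ≤ ∑ t, (I₀.optMean - I₀.mean (Fin.last n) (h t).1) +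
            ∑ t, (I₁.optMean - I₁.mean (Fin.last n) (h t).1) := by
          rw [← Finset.sum_add_distrib]
          simpa using Finset.card_nsmul_le_sum Finset.univ _ G fun t _ => hG (h t).1
        calc _ ≤ ENNReal.ofReal (min (D₀ h) (D₁ h)) *
              (ENNReal.ofReal (∑ t, (I₀.optMean - I₀.mean (Fin.last n) (h t).1)) +
                ENNReal.ofReal (∑ t, (I₁.optMean - I₁.mean (Fin.last n) (h t).1))) := by
              gcongr
              exact (ENNReal.ofReal_le_ofReal hTG).trans ENNReal.ofReal_add_le
          _ ≤ _ := by
              rw [mul_add, mul_comm, mul_comm (ENNReal.ofReal (min (D₀ h) (D₁ h)))]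
              gcongr
              · exact min_le_left _ _
              · exact min_le_right _ _
    _ = _ := lintegral_add_left (by fun_prop) _

end CausalBandit

namespace CausalBandit

/-! ### The hierarchical instances -/

theorem layer_le_of_transGen {n d : ℕ} {j i : Fin (n + 1)}
    (h : Relation.TransGen (fun j i : Fin (n + 1) => (i : ℕ) / d = (j : ℕ) / d + 1) j i) :
    (j : ℕ) / d < (i : ℕ) / d := by
  induction h with
  | single h => omega
  | tail _ h ih => omega

/-- The weight of the edges into a node of the layer `k`. -/
noncomputable def layerWeight (s : ℝ) (k : ℕ) : ℝ := if k = 1 then 1 / 2 + s else 1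

theorem layerWeight_pos {s : ℝ} (hs : |s| ≤ 1 / 4) (k : ℕ) : 0 < layerWeight s k := by
  have := (abs_le.1 hs).1
  rw [layerWeight]
  split_ifs <;> linarith

/-- The hierarchical model in which the weights into the first layer with parents are perturbed
by `s`. -/
noncomputable def hierarchical (d L : ℕ) (s : ℝ) (hs : |s| ≤ 1 / 4) : CausalBandit (d * L) where
  edge j i := (i : ℕ) / d = (j : ℕ) / d + 1
  acyclic i h := (layer_le_of_transGen h).false
  B j i := if (i : ℕ) / d = (j : ℕ) / d + 1 then layerWeight s ((i : ℕ) / d) else 0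
  Bstar j i := if (i : ℕ) / d = (j : ℕ) / d + 1 then 1 / 2 else 0
  B_ne_zero_iff j i := by simp [(layerWeight_pos hs _).ne']
  Bstar_ne_zero_iff j i := by simp
  noise i := gaussianReal (if (i : ℕ) / d = 0 then 1 else 0) 1
  noise_prob i := inferInstance
  noise_integrable i := (memLp_id_gaussianReal' 1 (by simp)).integrable le_rfl

variable {d L : ℕ} {s : ℝ} {hs : |s| ≤ 1 / 4}

theorem layer_le (i : Fin (d * L + 1)) : (i : ℕ) / d ≤ L :=
  Nat.div_le_of_le_mul (Nat.lt_succ_iff.1 i.2)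

theorem card_layer (hd : 0 < d) {k : ℕ} (hk : k < L) :
    (Finset.univ.filter fun j : Fin (d * L + 1) => (j : ℕ) / d = k).card = d := by
  have h : (Finset.univ.filter fun j : Fin (d * L + 1) => (j : ℕ) / d = k).map Fin.valEmbedding =
      Finset.Ico (d * k) (d * k + d) := by
    ext m
    have h1 : m / d = k ↔ d * k ≤ m ∧ m < d * k + d := by
      rw [Nat.div_eq_iff hd, mul_comm k]
      omega
    simp only [Finset.mem_map, Finset.mem_filter, Finset.mem_univ, true_and, Finset.mem_Ico,
      Fin.valEmbedding_apply, ← h1]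
    constructor
    · rintro ⟨j, hj, rfl⟩
      exact hj
    · intro hm
      have h2 : d * (k + 1) ≤ d * L := Nat.mul_le_mul_left d hk
      rw [mul_add] at h2
      exact ⟨⟨m, by omega⟩, hm, rfl⟩
  rw [← Finset.card_map Fin.valEmbedding, h, Nat.card_Ico]
  omega

theorem card_parents (hd : 0 < d) {i : Fin (d * L + 1)} (hi : 1 ≤ (i : ℕ) / d) :
    (Finset.univ.filter fun j : Fin (d * L + 1) => (i : ℕ) / d = (j : ℕ) / d + 1).card = d := by
  have h := layer_le i
  refine Eq.trans ?_ (card_layer (L := L) hd (k := (i : ℕ) / d - 1) (by omega))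
  congr 1
  ext j
  simp only [Finset.mem_filter, Finset.mem_univ, true_and]
  omega

/-- From layer `L` on, only the reward node can occur. This case is needed for `L = 1`, when the
perturbed layer is the reward node itself. -/
theorem card_layer_le (hd : 0 < d) (k : ℕ) :
    (Finset.univ.filter fun j : Fin (d * L + 1) => (j : ℕ) / d = k).card ≤ d := by
  rcases lt_or_ge k L with hk | hk
  · exact (card_layer hd hk).le
  · refine le_trans (Finset.card_le_one.2 fun a ha b hb => ?_) hd
    have key : ∀ a : Fin (d * L + 1), (a : ℕ) / d = k → (a : ℕ) = d * L := by
      intro a ha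
      have h1 : d * L ≤ d * k := Nat.mul_le_mul_left d hk
      have h2 := Nat.mul_div_le (a : ℕ) d
      rw [ha] at h2
      have := a.2
      omega
    simp only [Finset.mem_filter, Finset.mem_univ, true_and] at ha hb
    exact Fin.ext ((key a ha).trans (key b hb).symm)

/-! ### The graph -/

theorem causalDepth_hierarchical (hd : 0 < d) (i : Fin (d * L + 1)) :
    (hierarchical d L s hs).causalDepth i = (i : ℕ) / d := by
  refine IsGreatest.csSup_eq ⟨?_, ?_⟩
  · have hb : ∀ m : Fin ((i : ℕ) / d + 1), d * (m : ℕ) < d * L + 1 := fun m =>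
      Nat.lt_succ_of_le (Nat.mul_le_mul_left d ((Nat.lt_succ_iff.1 m.2).trans (layer_le i)))
    -- A longest path runs through the first node `d * m` of each layer and ends at `i`.
    refine ⟨fun m => if m = Fin.last _ then i else ⟨d * m, hb m⟩, fun m => ?_, by simp⟩
    have h : ∀ m : Fin ((i : ℕ) / d + 1), (((if m = Fin.last _ then i else ⟨d * m, hb m⟩ :
        Fin (d * L + 1)) : Fin (d * L + 1)) : ℕ) / d = m := by
      intro m
      split_ifs with hm
      · simp [hm]
      · simp [Nat.mul_div_cancel_left _ hd]
    change (_ : ℕ) = _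
    rw [h, h]
    simp
  · rintro k ⟨p, hp, rfl⟩
    have h : ∀ m : Fin (k + 1), (m : ℕ) ≤ (p m : ℕ) / d := by
      intro m
      induction m using Fin.induction with
      | zero => simp
      | succ m ih =>
        have h1 : ((p m.succ : Fin (d * L + 1)) : ℕ) / d = (p m.castSucc : ℕ) / d + 1 := hp m
        rw [h1]
        simpa using ih
    simpa using h (Fin.last k)

theorem maxCausalDepth_hierarchical (hd : 0 < d) :
    (hierarchical d L s hs).maxCausalDepth = L := by
  refine le_antisymm (Finset.sup_le fun i _ => ?_) ?_
  · rw [causalDepth_hierarchical hd]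
    exact layer_le i
  · refine le_trans (le_of_eq ?_) (Finset.le_sup (Finset.mem_univ (Fin.last (d * L))))
    rw [causalDepth_hierarchical hd, Fin.val_last, Nat.mul_div_cancel_left _ hd]

theorem maxInDegree_hierarchical (hd : 0 < d) (hL : 0 < L) :
    (hierarchical d L s hs).maxInDegree = d := by
  have h : ∀ i : Fin (d * L + 1), {j | (hierarchical d L s hs).edge j i}.ncard =
      (Finset.univ.filter fun j : Fin (d * L + 1) => (i : ℕ) / d = (j : ℕ) / d + 1).card := by
    intro i
    rw [← Set.ncard_coe_finset]
    congr 1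
    ext j
    simp [hierarchical]
  refine le_antisymm (Finset.sup_le fun i _ => ?_) ?_
  · rw [h]
    rcases Nat.eq_zero_or_pos ((i : ℕ) / d) with hi | hi
    · simp [hi]
    · exact (card_parents hd hi).le
  · refine le_trans (le_of_eq ?_) (Finset.le_sup (Finset.mem_univ (Fin.last (d * L))))
    rw [h, card_parents hd]
    rwa [Fin.val_last, Nat.mul_div_cancel_left _ hd]

theorem weightsBounded_hierarchical : (hierarchical d L s hs).WeightsBounded := by
  intro j i
  have h1 := abs_le.1 hs
  have h2 : |layerWeight s ((i : ℕ) / d)| ≤ 1 := by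
    rw [abs_of_pos (layerWeight_pos hs _), layerWeight]
    split_ifs <;> linarith
  constructor
  · simp only [hierarchical]
    split_ifs
    · exact h2
    · simp
  · simp only [hierarchical]
    split_ifs <;> norm_num [abs_of_pos]

theorem gaussianNoise_hierarchical (hd : 0 < d) : (hierarchical d L s hs).GaussianNoise := by
  intro i
  rw [causalDepth_hierarchical hd]
  rfl

/-! ### The means -/

/-- The weight of the edges into the node `i` under the arm `a`. -/
noncomputable def armWeight (d : ℕ) (s : ℝ) {n : ℕ} (a : Finset (Fin (n + 1)))
    (i : Fin (n + 1)) : ℝ :=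
  if i ∈ a then 1 / 2 else layerWeight s ((i : ℕ) / d)

theorem armWeight_pos (hs : |s| ≤ 1 / 4) {n : ℕ} (a : Finset (Fin (n + 1)))
    (i : Fin (n + 1)) : 0 < armWeight d s a i := by
  rw [armWeight]
  split_ifs
  · norm_num
  · exact layerWeight_pos hs _

theorem weights_hierarchical (a : Finset (Fin (d * L + 1))) (j i : Fin (d * L + 1)) :
    (hierarchical d L s hs).weights a j i =
      if (i : ℕ) / d = (j : ℕ) / d + 1 then armWeight d s a i else 0 := by
  simp only [weights, hierarchical, Matrix.of_apply, armWeight]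
  split_ifs <;> rfl

theorem transpose_weights_mulVec (a : Finset (Fin (d * L + 1))) (x : Fin (d * L + 1) → ℝ)
    (i : Fin (d * L + 1)) :
    ((hierarchical d L s hs).weights a).transpose.mulVec x i =
      armWeight d s a i * ∑ j with (i : ℕ) / d = ((j : Fin (d * L + 1)) : ℕ) / d + 1, x j := by
  simp only [Matrix.mulVec, dotProduct, Matrix.transpose_apply, weights_hierarchical, ite_mul,
    zero_mul]
  rw [← Finset.sum_filter, Finset.mul_sum]

/-- Nodes are numbered layer by layer, so every edge increases the index and the matrix is
unitriangular. -/
theorem det_one_sub_weights (a : Finset (Fin (d * L + 1))) :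
    (1 - ((hierarchical d L s hs).weights a).transpose).det = 1 := by
  have h : ∀ i j : Fin (d * L + 1), i ≤ j → (hierarchical d L s hs).weights a j i = 0 := by
    intro i j hij
    rw [weights_hierarchical, if_neg]
    have : (i : ℕ) / d ≤ (j : ℕ) / d := Nat.div_le_div_right hij
    omega
  rw [Matrix.det_of_isLowerTriangular]
  · simp [h _ _ le_rfl]
  · intro i j hij
    have hij' : i < j := hij
    simp [h i j hij'.le, hij'.ne]

theorem mean_hierarchical (a : Finset (Fin (d * L + 1))) (i : Fin (d * L + 1)) :
    (hierarchical d L s hs).mean i a =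
      armWeight d s a i * (∑ j with (i : ℕ) / d = ((j : Fin (d * L + 1)) : ℕ) / d + 1,
        (hierarchical d L s hs).mean j a) + if (i : ℕ) / d = 0 then 1 else 0 := by
  rw [mean_eq_sum_add]
  congr 1
  · exact transpose_weights_mulVec a (fun j => (hierarchical d L s hs).mean j a) i
  · exact integral_id_gaussianReal

theorem mean_hierarchical_of_layer_zero (a : Finset (Fin (d * L + 1))) {i : Fin (d * L + 1)}
    (hi : (i : ℕ) / d = 0) : (hierarchical d L s hs).mean i a = 1 := by
  rw [mean_hierarchical]
  simp [hi]

theorem mean_hierarchical_of_pos (a : Finset (Fin (d * L + 1))) {i : Fin (d * L + 1)}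
    (hi : 1 ≤ (i : ℕ) / d) : (hierarchical d L s hs).mean i a =
      armWeight d s a i * ∑ j with (i : ℕ) / d = ((j : Fin (d * L + 1)) : ℕ) / d + 1,
        (hierarchical d L s hs).mean j a := by
  rw [mean_hierarchical, if_neg (by omega), add_zero]

/-- Induction along the layers. -/
theorem layer_induction {P : Fin (d * L + 1) → Prop}
    (h : ∀ i : Fin (d * L + 1), (∀ j : Fin (d * L + 1), (j : ℕ) / d < (i : ℕ) / d → P j) → P i)
    (i : Fin (d * L + 1)) : P i :=
  (measure fun i : Fin (d * L + 1) => (i : ℕ) / d).wf.induction i h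

theorem parents_nonempty (hd : 0 < d) {i : Fin (d * L + 1)} (hi : 1 ≤ (i : ℕ) / d) :
    (Finset.univ.filter fun j : Fin (d * L + 1) => (i : ℕ) / d = (j : ℕ) / d + 1).Nonempty := by
  rw [← Finset.card_pos, card_parents hd hi]
  exact hd

theorem mean_hierarchical_pos (hd : 0 < d) (a : Finset (Fin (d * L + 1))) (i : Fin (d * L + 1)) :
    0 < (hierarchical d L s hs).mean i a := by
  induction i using layer_induction with
  | h i ih =>
    rcases Nat.eq_zero_or_pos ((i : ℕ) / d) with hi | hi
    · rw [mean_hierarchical_of_layer_zero a hi]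
      exact one_pos
    · rw [mean_hierarchical_of_pos a hi]
      refine mul_pos (armWeight_pos hs a i) (Finset.sum_pos (fun j hj => ih j ?_)
        (parents_nonempty hd hi))
      rw [(Finset.mem_filter.1 hj).2]
      exact Nat.lt_succ_self _

/-- If the interventions only concern the first layer with parents, and all nodes of that layer
have the same weights, then the mean is the number of paths from the sources times this weight. -/
theorem mean_hierarchical_eq (hd : 0 < d) {a : Finset (Fin (d * L + 1))} {w : ℝ}
    (ha : ∀ i ∈ a, ((i : Fin (d * L + 1)) : ℕ) / d = 1)
    (hw : ∀ i : Fin (d * L + 1), (i : ℕ) / d = 1 → armWeight d s a i = w)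
    (i : Fin (d * L + 1)) (hi : 1 ≤ (i : ℕ) / d) :
    (hierarchical d L s hs).mean i a = (d : ℝ) ^ ((i : ℕ) / d) * w := by
  induction i using layer_induction with
  | h i ih =>
    rw [mean_hierarchical_of_pos a hi]
    rcases hi.eq_or_lt with hi1 | hi1
    · rw [hw i hi1.symm, Finset.sum_congr rfl fun j hj => mean_hierarchical_of_layer_zero a (i := j)
        (by have := (Finset.mem_filter.1 hj).2; omega), Finset.sum_const, card_parents hd hi,
        ← hi1]
      simp [mul_comm]
    · have hia : armWeight d s a i = 1 := by
        rw [armWeight, if_neg fun h => by have := ha i h; omega, layerWeight,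
          if_neg (by omega)]
      rw [hia, Finset.sum_congr rfl (g := fun _ => (d : ℝ) ^ ((i : ℕ) / d - 1) * w),
        Finset.sum_const, card_parents hd hi]
      · rw [one_mul, nsmul_eq_mul, ← mul_assoc, mul_comm (d : ℝ), pow_sub_one_mul (by omega)]
      · intro j hj
        have hj := (Finset.mem_filter.1 hj).2
        rw [ih j (by omega) (by omega), hj, Nat.add_sub_cancel]

/-- Opposite perturbations cancel in the means, whatever the arm. -/
theorem mean_neg_add_mean_le (hd : 0 < d) {hs' : |-s| ≤ 1 / 4} (a : Finset (Fin (d * L + 1)))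
    (i : Fin (d * L + 1)) (hi : 1 ≤ (i : ℕ) / d) :
    (hierarchical d L (-s) hs').mean i a + (hierarchical d L s hs).mean i a ≤
      (d : ℝ) ^ ((i : ℕ) / d) := by
  induction i using layer_induction with
  | h i ih =>
    rw [mean_hierarchical_of_pos a hi, mean_hierarchical_of_pos a hi]
    rcases hi.eq_or_lt with hi1 | hi1
    · have h : ∀ s (hs : |s| ≤ 1 / 4),
          ∑ j with (i : ℕ) / d = ((j : Fin (d * L + 1)) : ℕ) / d + 1,
            (hierarchical d L s hs).mean j a = d := by
        intro s hs
        rw [Finset.sum_congr rfl fun j hj => mean_hierarchical_of_layer_zero a (i := j)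
          (by have := (Finset.mem_filter.1 hj).2; omega), Finset.sum_const, card_parents hd hi]
        simp
      rw [h, h, ← hi1, ← add_mul, pow_one]
      refine (mul_le_of_le_one_left (Nat.cast_nonneg d) (le_of_eq ?_))
      -- In layer 1 the two weights sum to one in either case: `1/2 + 1/2` with intervention, `(1/2
      -- - s) + (1/2 + s)` without.
      rw [armWeight, armWeight, ← hi1]
      split_ifs
      · norm_num
      · simp only [layerWeight, if_true]
        ring
    -- Beyond layer 1 the weights do not depend on `s` and are at most one, so the bound only grows
    -- by the number of parents.
    · have hia : ∀ s, armWeight d s a i = if i ∈ a then 1 / 2 else 1 := by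
        intro s
        rw [armWeight, layerWeight, if_neg (by omega : ¬ (i : ℕ) / d = 1)]
      rw [hia, hia, ← mul_add, ← Finset.sum_add_distrib]
      have hS : ∑ j with (i : ℕ) / d = ((j : Fin (d * L + 1)) : ℕ) / d + 1,
          ((hierarchical d L (-s) hs').mean j a + (hierarchical d L s hs).mean j a) ≤
            (d : ℝ) ^ ((i : ℕ) / d) := by
        have h1 := Finset.sum_le_card_nsmul
          (Finset.univ.filter fun j : Fin (d * L + 1) => (i : ℕ) / d = (j : ℕ) / d + 1)
          (fun j => (hierarchical d L (-s) hs').mean j a + (hierarchical d L s hs).mean j a)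
          ((d : ℝ) ^ ((i : ℕ) / d - 1)) fun j hj => by
            have hj := (Finset.mem_filter.1 hj).2
            have := ih j (by omega) (by omega)
            rwa [hj, Nat.add_sub_cancel]
        rw [card_parents hd hi, nsmul_eq_mul, mul_comm (d : ℝ), pow_sub_one_mul (by omega)] at h1
        exact h1
      refine (mul_le_of_le_one_left ?_ ?_).trans hS
      · exact Finset.sum_nonneg fun j _ =>
          add_nonneg (mean_hierarchical_pos hd a j).le (mean_hierarchical_pos hd a j).le
      · split_ifs <;> norm_num

/-! ### Interventions on single nodes -/

theorem mean_hierarchical_singleton_of_lt {i : Fin (d * L + 1)} (j : Fin (d * L + 1))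
    (hj : (j : ℕ) / d < (i : ℕ) / d) :
    (hierarchical d L s hs).mean j {i} = (hierarchical d L s hs).mean j ∅ := by
  induction j using layer_induction with
  | h j ih =>
    have hji : j ≠ i := by
      rintro rfl
      exact hj.false
    rw [mean_hierarchical, mean_hierarchical ∅]
    simp only [armWeight, Finset.mem_singleton, hji, Finset.notMem_empty, if_false]
    congr 2
    refine Finset.sum_congr rfl fun k hk => ih k ?_ ?_ <;>
    · have := (Finset.mem_filter.1 hk).2
      omega

theorem mean_sub_mean_singleton {i j : Fin (d * L + 1)} (hj : j ≠ i) :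
    (hierarchical d L s hs).mean j ∅ - (hierarchical d L s hs).mean j {i} =
      layerWeight s ((j : ℕ) / d) *
        ∑ k with (j : ℕ) / d = ((k : Fin (d * L + 1)) : ℕ) / d + 1,
          ((hierarchical d L s hs).mean k ∅ - (hierarchical d L s hs).mean k {i}) := by
  rw [mean_hierarchical, mean_hierarchical {i}]
  simp only [armWeight, Finset.mem_singleton, hj, Finset.notMem_empty, if_false,
    Finset.sum_sub_distrib]
  ring

theorem mean_sub_mean_singleton_self {i : Fin (d * L + 1)} (hi : 1 ≤ (i : ℕ) / d) :
    (hierarchical d L s hs).mean i ∅ - (hierarchical d L s hs).mean i {i} =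
      (layerWeight s ((i : ℕ) / d) - 1 / 2) *
        ∑ k with (i : ℕ) / d = ((k : Fin (d * L + 1)) : ℕ) / d + 1,
          (hierarchical d L s hs).mean k ∅ := by
  rw [mean_hierarchical_of_pos _ hi, mean_hierarchical_of_pos _ hi,
    Finset.sum_congr rfl fun k hk => mean_hierarchical_singleton_of_lt (i := i) k
      (by have := (Finset.mem_filter.1 hk).2; omega)]
  simp only [armWeight, Finset.mem_singleton, Finset.notMem_empty, if_false, if_true]
  ring

/-- The intervention changes the mean of `i` by the change of weight (`±s` or `1/2`) times a
positive sum, and this effect is transported along edges of positive weight, so that contributions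
of different paths cannot cancel. -/
theorem mean_ne_mean_singleton (hd : 0 < d) (hs0 : s ≠ 0) {i j : Fin (d * L + 1)}
    (hi : 1 ≤ (i : ℕ) / d)
    (hij : Relation.ReflTransGen (hierarchical d L s hs).edge i j) :
    (hierarchical d L s hs).mean j ∅ - (hierarchical d L s hs).mean j {i} ≠ 0 := by
  set c := layerWeight s ((i : ℕ) / d) - 1 / 2 with hc
  have hc0 : c ≠ 0 := by
    rw [hc, layerWeight]
    split_ifs
    · simpa using hs0
    · norm_num
  -- Dividing by `c` removes the sign, since `c` is negative in layer 1 when `s < 0`.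
  set p : Fin (d * L + 1) → ℝ := fun j =>
    ((hierarchical d L s hs).mean j ∅ - (hierarchical d L s hs).mean j {i}) / c with hp
  have hpi : 0 < p i := by
    simp only [hp]
    rw [mean_sub_mean_singleton_self hi, mul_div_cancel_left₀ _ hc0]
    exact Finset.sum_pos (fun k _ => mean_hierarchical_pos hd _ k) (parents_nonempty hd hi)
  have hpj : ∀ j ≠ i, p j = layerWeight s ((j : ℕ) / d) *
      ∑ k with (j : ℕ) / d = ((k : Fin (d * L + 1)) : ℕ) / d + 1, p k := by
    intro j hj
    simp only [hp]
    rw [mean_sub_mean_singleton hj, mul_div_assoc, Finset.sum_div]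
  have hp0 : ∀ j, 0 ≤ p j := by
    intro j
    induction j using layer_induction with
    | h j ih =>
      by_cases hj : j = i
      · rw [hj]
        exact hpi.le
      · rw [hpj j hj]
        refine mul_nonneg (layerWeight_pos hs _).le (Finset.sum_nonneg fun k hk => ih k ?_)
        have := (Finset.mem_filter.1 hk).2
        omega
  have hpos : 0 < p j := by
    induction hij with
    | refl => exact hpi
    | @tail k j hik hkj ih =>
      have hji : j ≠ i := by
        rintro rfl
        exact (hierarchical d L s hs).acyclic j (Relation.TransGen.tail' hik hkj)
      rw [hpj j hji]
      exact mul_pos (layerWeight_pos hs _) (ih.trans_le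
        (Finset.single_le_sum (fun k _ => hp0 k) (Finset.mem_filter.2 ⟨Finset.mem_univ k, hkj⟩)))
  intro h0
  simp [hp, h0] at hpos

theorem exists_interventionRegular_hierarchical (hd : 0 < d) (hs0 : s ≠ 0) :
    ∃ η : ℝ, 0 < η ∧ (hierarchical d L s hs).InterventionRegular η := by
  classical
  -- The value `1` at irrelevant pairs keeps the minimum positive; half the minimum then gives a
  -- strict inequality.
  let f : Fin (d * L + 1) × Fin (d * L + 1) → ℝ := fun p =>
    if 1 ≤ (p.1 : ℕ) / d ∧ Relation.ReflTransGen (hierarchical d L s hs).edge p.1 p.2 then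
      |(hierarchical d L s hs).mean p.2 ∅ - (hierarchical d L s hs).mean p.2 {p.1}| else 1
  obtain ⟨p₀, -, hp₀⟩ := Finset.exists_min_image Finset.univ f Finset.univ_nonempty
  have hf : 0 < f p₀ := by
    simp only [f]
    split_ifs with h
    · exact abs_pos.2 (mean_ne_mean_singleton hd hs0 h.1 h.2)
    · exact one_pos
  refine ⟨f p₀ / 2, half_pos hf, fun i j hi hij => ?_⟩
  rw [causalDepth_hierarchical hd] at hi
  have h := hp₀ (i, j) (Finset.mem_univ _)
  have hfij : f (i, j) =
      |(hierarchical d L s hs).mean j ∅ - (hierarchical d L s hs).mean j {i}| := if_pos ⟨hi, hij⟩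
  rw [hfij] at h
  linarith

end CausalBandit

namespace CausalBandit

variable {d L : ℕ} {s : ℝ} {hs : |s| ≤ 1 / 4}

/-! ### Densities of the hierarchical instances -/

/-- The mean of the noise. -/
noncomputable def noiseMean (d : ℕ) {n : ℕ} (i : Fin (n + 1)) : ℝ :=
  if (i : ℕ) / d = 0 then 1 else 0

/-- The derivative in `s` of the structural equation of the node `i` under the arm `a`. -/
noncomputable def drift (d : ℕ) {n : ℕ} (p : BanditRound n) (i : Fin (n + 1)) : ℝ :=
  if (i : ℕ) / d = 1 ∧ i ∉ p.1 then ∑ j with ((j : Fin (n + 1)) : ℕ) / d = 0, p.2 j else 0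

/-- The noise at the node `i` that explains the observation if the perturbation vanishes. -/
noncomputable def residual (d : ℕ) {n : ℕ} (p : BanditRound n) (i : Fin (n + 1)) : ℝ :=
  p.2 i - armWeight d 0 p.1 i * ∑ j with (i : ℕ) / d = ((j : Fin (n + 1)) : ℕ) / d + 1, p.2 j

theorem measurable_drift {n : ℕ} (i : Fin (n + 1)) :
    Measurable fun p : BanditRound n => drift d p i := by
  refine measurable_from_prod_countable_right fun a => ?_
  by_cases h : (i : ℕ) / d = 1 ∧ i ∉ a
  · simp only [drift, h, not_false_eq_true, and_self, if_true]
    fun_prop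
  · simp only [drift, h, if_false]
    exact measurable_const

theorem measurable_residual {n : ℕ} (i : Fin (n + 1)) :
    Measurable fun p : BanditRound n => residual d p i := by
  refine measurable_from_prod_countable_right fun a => ?_
  simp only [residual]
  fun_prop

/-- Each weight is affine in `s`, with slope one at the nodes of layer 1 outside `a` and zero
elsewhere. -/
theorem sub_transpose_weights_mulVec (a : Finset (Fin (d * L + 1))) (x : Fin (d * L + 1) → ℝ)
    (i : Fin (d * L + 1)) :
    x i - ((hierarchical d L s hs).weights a).transpose.mulVec x i =
      residual d (a, x) i - s * drift d (a, x) i := by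
  rw [transpose_weights_mulVec, residual, drift]
  by_cases hi : (i : ℕ) / d = 1
  · have h : ∀ j : Fin (d * L + 1), (i : ℕ) / d = (j : ℕ) / d + 1 ↔ (j : ℕ) / d = 0 := by
      intro j
      omega
    simp only [h]
    simp only [armWeight, layerWeight, hi, true_and, if_true]
    split_ifs <;> ring
  · simp only [armWeight, layerWeight, hi, false_and, if_false]
    ring

/-- The density of the model with perturbation `s` with respect to the unperturbed one. -/
noncomputable def densityRatio (d : ℕ) (s : ℝ) {n : ℕ} (p : BanditRound n) : ℝ :=
  ∏ i, gaussianPDFReal (noiseMean d i) 1 (residual d p i - s * drift d p i) /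
    gaussianPDFReal (noiseMean d i) 1 (residual d p i)

/-- Both models have a Gaussian density with unit Jacobian, and that of the unperturbed one never
vanishes, so the density is their quotient. -/
theorem isObsDensity_hierarchical (hs₀ : |(0 : ℝ)| ≤ 1 / 4) :
    IsObsDensity (hierarchical d L s hs) (hierarchical d L 0 hs₀) (densityRatio d s) := by
  have hm : Measurable (densityRatio d s (n := d * L)) := by
    have h1 := measurable_drift (d := d) (n := d * L)
    have h2 := measurable_residual (d := d) (n := d * L)
    unfold densityRatio
    fun_prop
  refine ⟨hm, fun p => Finset.prod_nonneg fun i _ => div_nonneg (gaussianPDFReal_nonneg _ _ _)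
    (gaussianPDFReal_nonneg _ _ _), fun a f hf => ?_⟩
  have hma : Measurable fun x => densityRatio d s (a, x) := hm.comp measurable_prodMk_left
  rw [lintegral_obs_of_gaussian _ (m := noiseMean d) (fun i => rfl) a (det_one_sub_weights a) hf,
    lintegral_obs_of_gaussian _ (m := noiseMean d) (fun i => rfl) a (det_one_sub_weights a)
      (by fun_prop)]
  refine lintegral_congr fun x => ?_
  have hpos : ∀ i, 0 < gaussianPDFReal (noiseMean d i) 1 (residual d (a, x) i) := fun i =>
    gaussianPDFReal_pos _ _ _ one_ne_zero
  simp only [sub_transpose_weights_mulVec, zero_mul, sub_zero]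
  rw [mul_assoc, ← ENNReal.ofReal_mul' (Finset.prod_nonneg fun i _ => (hpos i).le), densityRatio,
    ← Finset.prod_mul_distrib]
  simp only [div_mul_cancel₀ _ (hpos _).ne']

/-- Half the squared drift, which controls the affinity of two opposite perturbations. -/
noncomputable def information (d : ℕ) (s : ℝ) {n : ℕ} (p : BanditRound n) : ℝ :=
  (∑ i, (s * drift d p i) ^ 2) / 2

/-- The residuals cancel between opposite shifts; this is why the reference model is the midpoint of
the two instances. -/
theorem densityRatio_mul (s : ℝ) {n : ℕ} (p : BanditRound n) :
    densityRatio d (-s) p * densityRatio d s p = Real.exp (-(2 * information d s p)) := by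
  rw [densityRatio, densityRatio, ← Finset.prod_mul_distrib, information,
    mul_div_cancel₀ _ two_ne_zero, ← Finset.sum_neg_distrib, Real.exp_sum]
  refine Finset.prod_congr rfl fun i _ => ?_
  have hpos : 0 < gaussianPDFReal (noiseMean d i) 1 (residual d p i) :=
    gaussianPDFReal_pos _ _ _ one_ne_zero
  rw [neg_mul, sub_neg_eq_add, div_mul_div_comm, mul_comm (gaussianPDFReal _ _ (_ + _)),
    gaussianPDFReal_sub_mul_gaussianPDFReal_add, div_eq_iff (by positivity)]
  ring

theorem information_le (hd : 0 < d) (s : ℝ) (p : BanditRound (d * L)) :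
    information d s p ≤ (d : ℝ) ^ 2 * s ^ 2 / 2 *
      ∑ j with ((j : Fin (d * L + 1)) : ℕ) / d = 0, p.2 j ^ 2 := by
  set S := ∑ j with ((j : Fin (d * L + 1)) : ℕ) / d = 0, p.2 j ^ 2 with hS
  have hS0 : 0 ≤ S := Finset.sum_nonneg fun j _ => sq_nonneg _
  -- Cauchy-Schwarz over the sources, of which there are at most `d`.
  have hcs : (∑ j with ((j : Fin (d * L + 1)) : ℕ) / d = 0, p.2 j) ^ 2 ≤ d * S := by
    refine sq_sum_le_card_mul_sum_sq.trans ?_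
    gcongr
    exact card_layer_le hd 0
  have h1 : ∀ i, (s * drift d p i) ^ 2 ≤ if (i : ℕ) / d = 1 then s ^ 2 * (d * S) else 0 := by
    intro i
    rw [drift, mul_pow]
    by_cases hi : (i : ℕ) / d = 1
    · rw [if_pos hi]
      gcongr
      split_ifs
      · exact hcs
      · simpa using by positivity
    · simp [hi]
  have h2 : ∑ i, (s * drift d p i) ^ 2 ≤ d * (s ^ 2 * (d * S)) := by
    refine (Finset.sum_le_sum fun i _ => h1 i).trans ?_
    rw [← Finset.sum_filter, Finset.sum_const, nsmul_eq_mul]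
    gcongr
    exact card_layer_le hd 1
  rw [information]
  linarith

/-- A source has no parents and shows its own noise, of second moment `1 + 1`. -/
theorem lintegral_sq_obs_of_layer_zero (a : Finset (Fin (d * L + 1))) {j : Fin (d * L + 1)}
    (hj : (j : ℕ) / d = 0) :
    ∫⁻ x, ENNReal.ofReal (x j ^ 2) ∂((hierarchical d L s hs).obs a) = 2 := by
  have := (hierarchical d L s hs).noise_prob
  have hsol : ∀ ε, (hierarchical d L s hs).solution a ε j = ε j := by
    intro ε
    have h := congrFun (((hierarchical d L s hs).eq_solution_iff a ε _).1 rfl) j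
    rw [Pi.add_apply, transpose_weights_mulVec] at h
    simpa [hj] using h
  rw [obs_apply, lintegral_map (by fun_prop) (measurable_solution _ a)]
  simp only [hsol]
  rw [(measurePreserving_eval (hierarchical d L s hs).noise j).lintegral_comp
    (f := fun y : ℝ => ENNReal.ofReal (y ^ 2)) (by fun_prop)]
  simp only [hierarchical, hj, if_true]
  exact lintegral_sq_gaussianReal_one_one

theorem lintegral_information_le (hd : 0 < d) (r : ℝ) (a : Finset (Fin (d * L + 1))) :
    ∫⁻ x, ENNReal.ofReal (information d r (a, x)) ∂((hierarchical d L s hs).obs a) ≤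
      ENNReal.ofReal ((d : ℝ) ^ 3 * r ^ 2) := by
  calc _ ≤ ∫⁻ x, ENNReal.ofReal ((d : ℝ) ^ 2 * r ^ 2 / 2) *
        ∑ j with ((j : Fin (d * L + 1)) : ℕ) / d = 0, ENNReal.ofReal (x j ^ 2)
          ∂((hierarchical d L s hs).obs a) := by
        refine lintegral_mono fun x => ?_
        rw [← ENNReal.ofReal_sum_of_nonneg fun j _ => sq_nonneg _,
          ← ENNReal.ofReal_mul (by positivity)]
        exact ENNReal.ofReal_le_ofReal (information_le hd r (a, x))
    _ = ENNReal.ofReal ((d : ℝ) ^ 2 * r ^ 2 / 2) *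
        ((Finset.univ.filter fun j : Fin (d * L + 1) => (j : ℕ) / d = 0).card * 2) := by
        rw [lintegral_const_mul _ (by fun_prop), lintegral_finsetSum _ (by fun_prop),
          Finset.sum_congr rfl fun j hj =>
            lintegral_sq_obs_of_layer_zero a (Finset.mem_filter.1 hj).2,
          Finset.sum_const, nsmul_eq_mul]
    _ ≤ ENNReal.ofReal ((d : ℝ) ^ 2 * r ^ 2 / 2) * (d * 2) := by
        gcongr
        exact card_layer_le hd 0
    _ = _ := by
        rw [← ENNReal.ofReal_natCast, ← ENNReal.ofReal_ofNat,
          ← ENNReal.ofReal_mul (by positivity), ← ENNReal.ofReal_mul (by positivity)]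
        congr 1
        ring

/-! ### The lower bound -/

/-- Intervening on all of layer 1 for `-s` and on nothing for `s` bounds the sum of the optima below
by `d ^ L * (1 + s)`, whereas any common arm achieves at most `d ^ L`. -/
theorem pow_mul_le_gap_add_gap (hd : 0 < d) (hL : 1 ≤ L) {hs' : |-s| ≤ 1 / 4}
    (a : Finset (Fin (d * L + 1))) :
    (d : ℝ) ^ L * s ≤
      ((hierarchical d L (-s) hs').optMean - (hierarchical d L (-s) hs').mean (Fin.last _) a) +
      ((hierarchical d L s hs).optMean - (hierarchical d L s hs).mean (Fin.last _) a) := by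
  have hlast : ((Fin.last (d * L) : Fin (d * L + 1)) : ℕ) / d = L := by
    rw [Fin.val_last, Nat.mul_div_cancel_left _ hd]
  have h0 := mean_hierarchical_eq (hs := hs') (w := 1 / 2)
    (a := Finset.univ.filter fun i : Fin (d * L + 1) => (i : ℕ) / d = 1) hd (by simp)
    (fun i hi => by simp [armWeight, hi]) (Fin.last _) (by rwa [hlast])
  have h1 := mean_hierarchical_eq (hs := hs) (w := 1 / 2 + s) (a := ∅) hd (by simp)
    (fun i hi => by simp [armWeight, layerWeight, hi]) (Fin.last _) (by rwa [hlast])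
  have h2 := mean_neg_add_mean_le (hs := hs) (hs' := hs') hd a (Fin.last _) (by rwa [hlast])
  have h3 := (hierarchical d L (-s) hs').mean_le_optMean
    (Finset.univ.filter fun i : Fin (d * L + 1) => (i : ℕ) / d = 1)
  have h4 := (hierarchical d L s hs).mean_le_optMean ∅
  rw [hlast] at h0 h1 h2
  linarith

end CausalBandit

theorem mainTheorem2 :
    ∃ c : ℝ, 0 < c ∧ ∀ d L T : ℕ, 1 ≤ d → 1 ≤ L → 1 ≤ T →
      ∃ I₀ I₁ : CausalBandit (d * L),
        (∀ I : CausalBandit (d * L), I = I₀ ∨ I = I₁ →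
          I.IsHierarchical d ∧ I.maxInDegree = d ∧ I.maxCausalDepth = L ∧
          I.WeightsBounded ∧ I.GaussianNoise ∧ ∃ η : ℝ, 0 < η ∧ I.InterventionRegular η) ∧
        ∀ π : BanditPolicy (d * L),
          c * (d : ℝ) ^ ((L : ℝ) - 3 / 2) * √(T : ℝ) ≤
            max (I₀.expectedRegret π T) (I₁.expectedRegret π T) := by
  -- A factor `1/4` comes from the choice of `s`, `1/4` from the two-point bound, and `1/2` from
  -- passing from the sum of the regrets to their maximum.
  refine ⟨1 / 32, by norm_num, fun d L T hd hL hT => ?_⟩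
  have hd1 : (1 : ℝ) ≤ d := by exact_mod_cast hd
  have hT1 : (1 : ℝ) ≤ T := by exact_mod_cast hT
  have hd0 : (0 : ℝ) < d := by linarith
  set e : ℝ := (d : ℝ) ^ (3 / 2 : ℝ) with he
  have he1 : 1 ≤ e := Real.one_le_rpow hd1 (by norm_num)
  have he2 : e ^ 2 = (d : ℝ) ^ 3 := by
    rw [he, ← Real.rpow_natCast, ← Real.rpow_mul hd0.le, ← Real.rpow_natCast]
    norm_num
  have hq1 : 1 ≤ √(T : ℝ) := Real.one_le_sqrt.2 hT1
  have hq2 : √(T : ℝ) ^ 2 = T := Real.sq_sqrt (by linarith)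
  -- This makes the total information at most `T * d ^ 3 * s ^ 2 = 1/16`, below the permitted `1/4`,
  -- and the factor `1/4` ensures `|s| ≤ 1/4` for all `d`, `T`.
  set s : ℝ := 1 / (4 * (e * √(T : ℝ))) with hsdef
  have heq : 1 ≤ e * √(T : ℝ) := one_le_mul_of_one_le_of_one_le he1 hq1
  have hs0 : 0 < s := by positivity
  have hs : |s| ≤ 1 / 4 := by
    rw [abs_of_pos hs0, hsdef]
    gcongr
    linarith
  have hs' : |-s| ≤ 1 / 4 := by rwa [abs_neg]
  have hs₀ : |(0 : ℝ)| ≤ 1 / 4 := by norm_num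
  refine ⟨.hierarchical d L (-s) hs', .hierarchical d L s hs, ?_, fun π => ?_⟩
  · have h : ∀ r (hr : |r| ≤ 1 / 4), r ≠ 0 →
        (CausalBandit.hierarchical d L r hr).IsHierarchical d ∧
        (CausalBandit.hierarchical d L r hr).maxInDegree = d ∧
        (CausalBandit.hierarchical d L r hr).maxCausalDepth = L ∧
        (CausalBandit.hierarchical d L r hr).WeightsBounded ∧
        (CausalBandit.hierarchical d L r hr).GaussianNoise ∧
        ∃ η : ℝ, 0 < η ∧ (CausalBandit.hierarchical d L r hr).InterventionRegular η :=
      fun r hr hr0 => ⟨fun j i => Iff.rfl, CausalBandit.maxInDegree_hierarchical hd hL,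
        CausalBandit.maxCausalDepth_hierarchical hd, CausalBandit.weightsBounded_hierarchical,
        CausalBandit.gaussianNoise_hierarchical hd,
        CausalBandit.exists_interventionRegular_hierarchical hd hr0⟩
    rintro I (rfl | rfl)
    · exact h _ hs' (neg_ne_zero.2 hs0.ne')
    · exact h _ hs hs0.ne'
  · have hTs : T * ((d : ℝ) ^ 3 * s ^ 2) = 1 / 16 := by
      have hs2 : s ^ 2 = 1 / (16 * ((d : ℝ) ^ 3 * T)) := by
        rw [hsdef, div_pow, mul_pow, mul_pow, he2, hq2]
        norm_num
      rw [hs2]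
      field_simp
    have hinf : Measurable (CausalBandit.information d s (n := d * L)) := by
      have := CausalBandit.measurable_drift (d := d) (n := d * L)
      unfold CausalBandit.information
      fun_prop
    have hreg := CausalBandit.le_expectedRegret_add _ _ _
      (CausalBandit.isObsDensity_hierarchical (d := d) (L := L) (hs := hs') hs₀)
      (CausalBandit.isObsDensity_hierarchical (hs := hs) hs₀) hinf
      (fun p => div_nonneg (Finset.sum_nonneg fun i _ => sq_nonneg _) zero_le_two)
      (CausalBandit.densityRatio_mul s) (T := T)
      (CausalBandit.lintegral_information_le hd s)
      (by
        rw [← ENNReal.ofReal_natCast, ← ENNReal.ofReal_mul (by positivity), hTs]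
        exact ENNReal.ofReal_le_ofReal (by norm_num))
      (CausalBandit.pow_mul_le_gap_add_gap hd hL) π
    have hval : T * ((d : ℝ) ^ L * s) / 4 =
        2 * (1 / 32 * (d : ℝ) ^ ((L : ℝ) - 3 / 2) * √(T : ℝ)) := by
      rw [Real.rpow_sub hd0, Real.rpow_natCast, ← he, hsdef]
      nth_rewrite 1 [← hq2]
      field_simp
      norm_num
    rw [hval] at hreg
    have h1 := le_max_left ((CausalBandit.hierarchical d L (-s) hs').expectedRegret π T)
      ((CausalBandit.hierarchical d L s hs).expectedRegret π T)
    have h2 := le_max_right ((CausalBandit.hierarchical d L (-s) hs').expectedRegret π T)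
      ((CausalBandit.hierarchical d L s hs).expectedRegret π T)
    linarith
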